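/- Let $B=(V,E,\preceq)$ be an ordered Bratteli diagram: finite vertex sets $V_0=\{v_0\},V_1,V_2,\dots$, finite edge sets $E_n$ $(n\ge 1)$ of edges from $V_{n-1}$ to $V_n$ such that every vertex of $V_n$ is the end of some edge of $E_n$ ($n\ge1$) and the start of some edge of $E_{n+1}$ ($n\ge0$), and a partial order on each $E_n$ in which two edges are comparable exactly when they have the same end-point. Suppose that $B$ is properly ordered, i.e. there are a unique infinite path from $v_0$ all of whose edges are maximal and a unique one all of whose edges are minimal, and let $(X,T)$ be the associated Bratteli–Vershik system: $X$ is the space of infinite paths from $v_0$ with the topology generated by cylinder sets, and $T$ is the Vershik map (the first non-maximal edge of a path is replaced by its successor, the edges before it by the minimal path from $v_0$ to the start of that successor, and the later edges are kept; the maximal path is sent to the minimal path). Suppose further that, for some integer $d$: * $B$ is proper with $d$ vertices per level: exactly one edge joins $v_0$ to each vertex of $V_1$; for $n\ge2$ every vertex of $V_{n-1}$ is joined to every vertex of $V_n$ by at least one edge, $\#V_n=d$ (and $V_n$ is identified with $\{1,\dots,d\}$), and all maximal edges of $E_n$ start at the same vertex; * $B$ is of Toeplitz type: for each $n\ge1$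 the number $q_n$ of edges of $E_n$ ending at a vertex $t\in V_n$ does not depend on $t$; put $p_n=q_1q_2\cdots q_n$; * $B$ is clean: writing $\tau_n(x)\in V_n$ for the vertex of level $n$ on the path $x$ and $\mathcal M_{erg}(X,T)$ for the set of ergodic $T$-invariant Borel probability measures, there are $\delta>0$ and a set $I_\mu\subseteq\{1,\dots,d\}$ for each $\mu\in\mathcal M_{erg}(X,T)$ such that $\mu(\tau_n=t)\ge\delta$ for all $t\in I_\mu$ and $n\ge2$, $\lim_{n\to\infty}\mu(\tau_n=t)=0$ for all $t\notin I_\mu$, and $I_\mu\cap I_\nu=\emptyset$ whenever $\mu\neq\nu$. A number $\lambda\in\mathbb C$ is an eigenvalue for $\mu$ if $f\circ T=\lambda f$ $\mu$-a.e. for some $f\in L^2(X,\mu)$, $f\ne0$; it is a continuous eigenvalue if $f\circ T=\lambda f$ for some continuous $f:X\to\mathbb C$, $f\neq0$; a non continuous eigenvalue for $\mu$ is an eigenvalue for $\mu$ that is not a continuous eigenvalue. For $\mu\in\mathcal M_{erg}(X,T)$ let $$\mathbf B_\mu=\Big\{\lim_{m\to\infty}\frac{b}{\gcd(b,p_m)}\;:\;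 b\ge1 \text{ an integer such that } \exp(2i\pi/b)\text{ is a non continuous eigenvalue for }\mu\Big\},$$ ordered by divisibility, and let $\mathcal M=\{\mu\in\mathcal M_{erg}(X,T):\mathbf B_\mu\ne\emptyset\}$. Then: 1. for all $\mu\in\mathcal M$ and $\mathbf b\in\mathbf B_\mu$, $\mathbf b\le \#I_\mu$; 2. for all $\mu\in\mathcal M$, $\mathbf B_\mu$ has a unique divisibility-maximal element $\mathbf b_\mu$; 3. $\sum_{\mu\in\mathcal M}\mathbf b_\mu\le d$; 4. $\mathcal M_{erg}(X,T)$ is finite and $\#\mathcal M\le\#\mathcal M_{erg}(X,T)\le d-\sum_{\mu\in\mathcal M}(\mathbf b_\mu-1)$. -/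

import Mathlib

open Filter Topology MeasureTheory

/-- An ordered Bratteli diagram.  `E n` is the set of edges between the vertices of `V n` and those
of `V (n + 1)` (level `n + 1` of the diagram).  Two edges are comparable exactly when they have the
same end-point. -/
structure OrderedBratteliDiagram where
  V : ℕ → Type
  E : ℕ → Type
  finV : ∀ n, Finite (V n)
  finE : ∀ n, Finite (E n)
  root : V 0
  eq_root : ∀ v : V 0, v = root
  src : ∀ n, E n → V n
  tgt : ∀ n, E n → V (n + 1)
  exists_src : ∀ n (v : V n), ∃ e, src n e = v
  exists_tgt : ∀ n (v : V (n + 1)), ∃ e, tgt n e = v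
  ord : ∀ n, PartialOrder (E n)
  comparable_iff : ∀ n (e e' : E n), (e ≤ e' ∨ e' ≤ e) ↔ tgt n e = tgt n e'

namespace OrderedBratteliDiagram

attribute [instance] finV finE ord

variable (B : OrderedBratteliDiagram)

/-- The set of infinite paths starting at the root. -/
def PathSpace : Type :=
  {x : ∀ n, B.E n // ∀ n, B.tgt n (x n) = B.src (n + 1) (x (n + 1))}

/-- The topology generated by the cylinders: the subspace topology from the product of the discrete
sets of edges. -/
instance : TopologicalSpace B.PathSpace :=
  TopologicalSpace.induced Subtype.val
    (@Pi.topologicalSpace ℕ B.E (fun _ => (⊥ : TopologicalSpace _)))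

instance : MeasurableSpace B.PathSpace := borel _

instance : BorelSpace B.PathSpace := ⟨rfl⟩

variable {B}

/-- All edges of the path are maximal among the edges with the same end-point. -/
def IsMaxPath (x : B.PathSpace) : Prop := ∀ n, IsMax (x.1 n)

/-- All edges of the path are minimal among the edges with the same end-point. -/
def IsMinPath (x : B.PathSpace) : Prop := ∀ n, IsMin (x.1 n)

variable (B) in
/-- There are a unique maximal and a unique minimal infinite path. -/
def IsProperlyOrdered : Prop :=
  (∃! x : B.PathSpace, IsMaxPath x) ∧ ∃! x : B.PathSpace, IsMinPath x

/-- `y` is obtained from the non-maximal path `x` by the Vershik rule: if `x n` is the first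
non-maximal edge of `x`, then `y n` is the successor of `x n`, the edges of `y` before `y n` are
minimal, and those after `y n` are those of `x`. -/
def VershikStep (x y : B.PathSpace) : Prop :=
  ∃ n, (∀ k < n, IsMax (x.1 k)) ∧ ¬ IsMax (x.1 n) ∧ x.1 n ⋖ y.1 n ∧
    (∀ k < n, IsMin (y.1 k)) ∧ ∀ k, n < k → y.1 k = x.1 k

theorem exists_isMin_tgt (n : ℕ) (v : B.V (n + 1)) : ∃ e : B.E n, B.tgt n e = v ∧ IsMin e := by
  obtain ⟨e, he⟩ := B.exists_tgt n v
  obtain ⟨m, hme, hm⟩ := Finite.exists_le_minimal (p := fun e : B.E n => B.tgt n e = v) he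
  refine ⟨m, hm.1, fun b hb => hm.2 ?_ hb⟩
  rw [← hm.1]
  exact (B.comparable_iff n b m).1 (Or.inl hb)

theorem eq_of_isMin {n : ℕ} {e e' : B.E n} (h : IsMin e) (h' : IsMin e')
    (ht : B.tgt n e = B.tgt n e') : e = e' := by
  rcases (B.comparable_iff n e e').2 ht with hle | hle
  · exact le_antisymm hle (h' hle)
  · exact le_antisymm (h hle) hle

theorem exists_path_of_tail (n : ℕ) (z : ∀ k, B.E k)
    (hz : ∀ k, n ≤ k → B.tgt k (z k) = B.src (k + 1) (z (k + 1))) :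
    ∃ y : B.PathSpace, (∀ k, n ≤ k → y.1 k = z k) ∧ ∀ k < n, IsMin (y.1 k) := by
  induction n generalizing z with
  | zero => exact ⟨⟨z, fun k => hz k (Nat.zero_le k)⟩, fun _ _ => rfl, fun k hk => by omega⟩
  | succ n ih =>
    obtain ⟨e, he, hmin⟩ := exists_isMin_tgt n (B.src (n + 1) (z (n + 1)))
    obtain ⟨y, hy, hy'⟩ := ih (Function.update z n e) (by
      intro k hk
      rcases Nat.eq_or_lt_of_le hk with rfl | hlt
      · rw [Function.update_self, Function.update_of_ne (by omega)]
        exact he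
      · rw [Function.update_of_ne (by omega), Function.update_of_ne (by omega)]
        exact hz k hlt)
    refine ⟨y, fun k hk => ?_, fun k hk => ?_⟩
    · rw [hy k (by omega), Function.update_of_ne (by omega)]
    · rcases Nat.eq_or_lt_of_le (Nat.le_of_lt_succ hk) with rfl | hlt
      · rw [hy k le_rfl, Function.update_self]
        exact hmin
      · exact hy' k hlt

/-- A path that is not maximal has exactly one image under the Vershik rule. -/
theorem existsUnique_vershikStep {x : B.PathSpace} (hx : ¬ IsMaxPath x) :
    ∃! y, VershikStep x y := by
  classical
  have hex : ∃ n, ¬ IsMax (x.1 n) := by simpa [IsMaxPath] using hx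
  obtain ⟨n, hn, hlt⟩ : ∃ n, ¬ IsMax (x.1 n) ∧ ∀ k < n, IsMax (x.1 k) :=
    ⟨Nat.find hex, Nat.find_spec hex, fun k hk => not_not.1 (Nat.find_min hex hk)⟩
  have tgt_of_le : ∀ {m : ℕ} {e e' : B.E m}, e ≤ e' → B.tgt m e = B.tgt m e' :=
    fun {m e e'} h => (B.comparable_iff m e e').1 (Or.inl h)
  obtain ⟨e, he⟩ : ∃ e, x.1 n ⋖ e := by
    obtain ⟨b, hb⟩ := not_isMax_iff.1 hn
    obtain ⟨m, -, hm⟩ := Finite.exists_le_minimal (p := fun c : B.E n => x.1 n < c) hb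
    exact ⟨m, hm.1, fun c hc hcm => (hm.2 hc hcm.le).not_gt hcm⟩
  obtain ⟨y, hy, hymin⟩ := exists_path_of_tail n (Function.update x.1 n e) (by
    intro k hk
    rcases Nat.eq_or_lt_of_le hk with rfl | hlt'
    · rw [Function.update_self, Function.update_of_ne (by omega), ← tgt_of_le he.le]
      exact x.2 _
    · rw [Function.update_of_ne (by omega), Function.update_of_ne (by omega)]
      exact x.2 k)
  refine ⟨y, ⟨n, hlt, hn, ?_, hymin, fun k hk => ?_⟩, ?_⟩
  · rw [hy n le_rfl, Function.update_self]
    exact he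
  · rw [hy k hk.le, Function.update_of_ne (by omega)]
  · rintro y' ⟨n', hlt', hn', hcov, hmin', htail⟩
    obtain rfl : n = n' := by
      rcases lt_trichotomy n n' with h | h | h
      · exact absurd (hlt' n h) hn
      · exact h
      · exact absurd (hlt n' h) hn'
    have hge : ∀ k, n ≤ k → y'.1 k = y.1 k := by
      intro k hk
      rcases Nat.eq_or_lt_of_le hk with rfl | hk'
      · rw [hy n le_rfl, Function.update_self]
        have ht : B.tgt n (y'.1 n) = B.tgt n e := by
          rw [← tgt_of_le hcov.le, tgt_of_le he.le]
        rcases (B.comparable_iff n _ _).2 ht with h | h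
        · exact h.eq_of_not_lt fun h' => he.2 hcov.1 h'
        · exact (h.eq_of_not_lt fun h' => hcov.2 he.1 h').symm
      · rw [htail k hk', hy k hk, Function.update_of_ne (by omega)]
    have hlow : ∀ j k, k + j = n → y'.1 k = y.1 k := by
      intro j
      induction j with
      | zero => exact fun k hk => hge k (by omega)
      | succ j ih =>
        intro k hk
        refine eq_of_isMin (hmin' k (by omega)) (hymin k (by omega)) ?_
        rw [y'.2 k, y.2 k, ih (k + 1) (by omega)]
    refine Subtype.ext (funext fun k => ?_)
    rcases le_or_gt n k with h | h
    · exact hge k h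
    · exact hlow (n - k) k (by omega)

open Classical in
/-- The Vershik map of a properly ordered Bratteli diagram; the maximal path is sent to the minimal
one. -/
noncomputable def vershikMap (hB : B.IsProperlyOrdered) (x : B.PathSpace) : B.PathSpace :=
  if hx : IsMaxPath x then hB.2.choose else (existsUnique_vershikStep hx).choose

/-- The vertex of level `n` through which the path goes, that is, the tower of the `n`-th
Kakutani-Rohlin partition to which the path belongs. -/
def tower (n : ℕ) (x : B.PathSpace) : B.V n := B.src n (x.1 n)

variable (B)

/-- The number of edges from `s` to `t`, an entry of the incidence matrix `M_{n+1}`. -/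
noncomputable def incidence (n : ℕ) (s : B.V n) (t : B.V (n + 1)) : ℕ :=
  Nat.card {e : B.E n // B.src n e = s ∧ B.tgt n e = t}

/-- The conditions for a diagram to be a proper representation with `d` vertices per level.  As
`E n` is level `n + 1`, the conditions on the levels `≥ 2` concern `E n` for `n ≥ 1`. -/
structure IsProper (d : ℕ) : Prop where
  /-- There is exactly one edge from the root to each vertex of level `1`. -/
  hat : ∀ s t, B.incidence 0 s t = 1
  /-- All other incidence matrices are positive. -/
  positive : ∀ n, 1 ≤ n → ∀ s t, 0 < B.incidence n s t
  card_vertices : ∀ n, 2 ≤ n → Nat.card (B.V n) = d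
  /-- All maximal edges of a level start at the same vertex. -/
  max_src : ∀ n, 1 ≤ n → ∀ e e' : B.E n, IsMax e → IsMax e' → B.src n e = B.src n e'

/-- The diagram is of Toeplitz type with characteristic sequence `q 0, q 1, …`: the number of edges
of `E n` that end at a vertex is `q n`, for every vertex. -/
def IsToeplitz (q : ℕ → ℕ) : Prop :=
  ∀ n (t : B.V (n + 1)), Nat.card {e : B.E n // B.tgt n e = t} = q n

variable {B}

/-- The set of ergodic invariant Borel probability measures of the Bratteli-Vershik system. -/
def ergodicMeasures (hB : B.IsProperlyOrdered) : Set (Measure B.PathSpace) :=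
  {μ | IsProbabilityMeasure μ ∧ Ergodic (vershikMap hB) μ}

/-- The diagram, whose vertices of each level `≥ 2` are identified with `Fin d` by `lab`, is clean,
and `I μ` is the set of vertices associated to the ergodic measure `μ`.  (The first two conditions
determine `I μ`.) -/
def IsClean (hB : B.IsProperlyOrdered) {d : ℕ} (lab : ∀ n, B.V (n + 2) ≃ Fin d)
    (I : Measure B.PathSpace → Finset (Fin d)) : Prop :=
  (∃ δ : ℝ, 0 < δ ∧ ∀ μ ∈ ergodicMeasures hB, ∀ t ∈ I μ, ∀ n,
      δ ≤ μ.real {x | lab n (tower (n + 2) x) = t}) ∧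
  (∀ μ ∈ ergodicMeasures hB, ∀ t ∉ I μ,
      Tendsto (fun n => μ.real {x | lab n (tower (n + 2) x) = t}) atTop (𝓝 0)) ∧
  ∀ μ ∈ ergodicMeasures hB, ∀ ν ∈ ergodicMeasures hB, μ ≠ ν → Disjoint (I μ) (I ν)

end OrderedBratteliDiagram

/-- `l` is a continuous eigenvalue of `T`. -/
def IsContinuousEigenvalue {X : Type*} [TopologicalSpace X] (T : X → X) (l : ℂ) : Prop :=
  ∃ f : X → ℂ, Continuous f ∧ f ≠ 0 ∧ ∀ x, f (T x) = l * f x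

/-- `l` is an eigenvalue of `T` with respect to `μ`, with eigenfunction in `L²(μ)`. -/
def IsMeasurableEigenvalue {X : Type*} [MeasurableSpace X] (T : X → X) (μ : Measure X) (l : ℂ) :
    Prop :=
  ∃ f : X → ℂ, MemLp f 2 μ ∧ ¬ f =ᵐ[μ] 0 ∧ ∀ᵐ x ∂μ, f (T x) = l * f x

def IsNonContinuousEigenvalue {X : Type*} [TopologicalSpace X] [MeasurableSpace X] (T : X → X)
    (μ : Measure X) (l : ℂ) : Prop :=
  IsMeasurableEigenvalue T μ l ∧ ¬ IsContinuousEigenvalue T l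

/-- `c` is maximal in `S` for the divisibility order. -/
def IsDvdMaximal (S : Set ℕ) (c : ℕ) : Prop := c ∈ S ∧ ∀ c' ∈ S, c ∣ c' → c' = c

namespace OrderedBratteliDiagram

variable {B : OrderedBratteliDiagram}

/-- The set of limits of `b / gcd (b, p_m)`, where `p_m` is the product of the first `m` terms of the
characteristic sequence, over the `b` for which `exp (2iπ/b)` is a non continuous eigenvalue for
`μ`. -/
def limitSet (hB : B.IsProperlyOrdered) (q : ℕ → ℕ) (μ : Measure B.PathSpace) : Set ℕ :=
  {c | ∃ b : ℕ, 0 < b ∧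
    IsNonContinuousEigenvalue (vershikMap hB) μ (Complex.exp (2 * Complex.I * Real.pi / b)) ∧
    Tendsto (fun m => b / Nat.gcd b (∏ i ∈ Finset.range m, q i)) atTop (𝓝 c)}

/-- The set of ergodic measures that have such a non continuous eigenvalue. -/
def nonContinuousMeasures (hB : B.IsProperlyOrdered) (q : ℕ → ℕ) : Set (Measure B.PathSpace) :=
  {μ | μ ∈ ergodicMeasures hB ∧ (limitSet hB q μ).Nonempty}

end OrderedBratteliDiagram

/-! In a diagram of Toeplitz type every tower of level `m` has `p_m` floors, and the Vershik map
raises the height by one modulo `p_m`. Let `l = exp (2iπ/b)` be an eigenvalue for `μ`, with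
unimodular eigenfunction `f`, and let `c` be the limit of `b / gcd (b, p_m)`. For large `m`, `l ^
p_m` is a primitive `c`-th root of unity. The function `g = l ^ (-height) * f` is constant along the
climb of a tower and is multiplied by `l ^ p_m` on return to the bottom. By ergodicity `g ^ c` is
constant, and since `T ^ p_m` rotates `g`, each of its `c` values has mass `1/c`. But `f` is close
in mean to a function of height and tower, so `g` is close to a function of the tower alone. The
towers outside `I μ` have negligible mass, so fewer than `c` towers cannot account for `c` values:
`c ≤ #(I μ)` (`one_le_of_card_lt`, `limit_le_card`).

Eigenvalues of orders `b₁` and `b₂` yield one of order `lcm b₁ b₂`, so the set of limits is directed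
for divisibility; being bounded, it has a greatest element (`exists_common_multiple_mem_limitSet`,
`exists_isDvdMaximal`). The trivial eigenvalue gives `1 ≤ #(I μ)`, and the remaining claims count
the disjoint sets `I μ` inside `Fin d`. -/

open scoped ENNReal

/-! ### Ranks of edges and heights in towers -/

namespace OrderedBratteliDiagram

variable {B : OrderedBratteliDiagram}

theorem tgt_eq_of_le {n : ℕ} {e e' : B.E n} (h : e ≤ e') : B.tgt n e = B.tgt n e' :=
  (B.comparable_iff n e e').1 (Or.inl h)

/-- The number of edges below `e`. -/
noncomputable def rank {n : ℕ} (e : B.E n) : ℕ := (Set.Iio e).ncard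

theorem rank_eq_zero {n : ℕ} {e : B.E n} (h : IsMin e) : rank e = 0 := by
  rw [rank, Set.ncard_eq_zero (Set.toFinite _)]
  exact h.Iio_eq

theorem rank_succ_eq_ncard_Iic {n : ℕ} (e : B.E n) : rank e + 1 = (Set.Iic e).ncard := by
  rw [rank, ← Set.Iio_insert, Set.ncard_insert_of_notMem (by simp) (Set.toFinite _)]

/-- Edges with a common end-point form a chain, so whatever is below `e'` is at most `e`. -/
theorem rank_of_covBy {n : ℕ} {e e' : B.E n} (h : e ⋖ e') : rank e' = rank e + 1 := by
  rw [rank_succ_eq_ncard_Iic, rank]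
  congr 1
  ext a
  refine ⟨fun ha => ?_, fun ha => lt_of_le_of_lt ha h.1⟩
  have ht : B.tgt n a = B.tgt n e := (tgt_eq_of_le (le_of_lt ha)).trans (tgt_eq_of_le h.1.le).symm
  rcases (B.comparable_iff n _ _).2 ht with hle | hle
  · exact hle
  · exact (hle.eq_of_not_lt fun hlt => h.2 hlt ha).ge

theorem eq_of_rank_eq {n : ℕ} {e e' : B.E n} (ht : B.tgt n e = B.tgt n e')
    (hr : rank e = rank e') : e = e' := by
  have key : ∀ {a b : B.E n}, a ≤ b → rank a = rank b → a = b := fun {a b} hab h => by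
    refine hab.eq_of_not_lt fun hlt => ?_
    have : (Set.Iio a).ncard < (Set.Iio b).ncard :=
      Set.ncard_lt_ncard ⟨Set.Iio_subset_Iio hab, fun hs => lt_irrefl a (hs hlt)⟩ (Set.toFinite _)
    exact this.ne h
  rcases (B.comparable_iff n _ _).2 ht with hle | hle
  · exact key hle hr
  · exact (key hle hr.symm).symm

namespace IsToeplitz

variable {q : ℕ → ℕ} (hq : B.IsToeplitz q)
include hq

theorem ncard_fiber (n : ℕ) (t : B.V (n + 1)) : {e : B.E n | B.tgt n e = t}.ncard = q n :=
  hq n t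

theorem rank_lt {n : ℕ} (e : B.E n) : rank e < q n := by
  rw [← hq.ncard_fiber n (B.tgt n e), ← Nat.succ_le_iff, Nat.succ_eq_add_one,
    rank_succ_eq_ncard_Iic]
  exact Set.ncard_le_ncard (fun a ha => tgt_eq_of_le ha) (Set.toFinite _)

theorem rank_of_isMax {n : ℕ} {e : B.E n} (h : IsMax e) : rank e + 1 = q n := by
  rw [← hq.ncard_fiber n (B.tgt n e), rank_succ_eq_ncard_Iic]
  congr 1
  ext a
  refine ⟨fun ha => tgt_eq_of_le ha, fun ha => ?_⟩
  rcases (B.comparable_iff n _ _).2 ha with hle | hle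
  · exact hle
  · exact h hle

end IsToeplitz

/-- The number of steps from the bottom of its tower of level `m` to the path `x`, for a diagram of
Toeplitz type with characteristic sequence `q`. -/
noncomputable def height (q : ℕ → ℕ) (m : ℕ) (x : B.PathSpace) : ℕ :=
  ∑ k ∈ Finset.range m, (∏ i ∈ Finset.range k, q i) * rank (x.1 k)

variable {q : ℕ → ℕ}

theorem height_succ (m : ℕ) (x : B.PathSpace) :
    height q (m + 1) x = height q m x + (∏ i ∈ Finset.range m, q i) * rank (x.1 m) :=
  Finset.sum_range_succ _ _

theorem height_eq_zero {m : ℕ} {x : B.PathSpace} (h : ∀ k < m, IsMin (x.1 k)) :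
    height q m x = 0 :=
  Finset.sum_eq_zero fun k hk => by rw [rank_eq_zero (h k (Finset.mem_range.1 hk)), mul_zero]

namespace IsToeplitz

variable (hq : B.IsToeplitz q)
include hq

/-- The height is a mixed-radix expansion whose `k`-th digit, the rank of the `k`-th edge, is less
than `q k`. -/
theorem height_lt (m : ℕ) (x : B.PathSpace) : height q m x < ∏ i ∈ Finset.range m, q i := by
  induction m with
  | zero => simp [height]
  | succ m ih =>
    rw [height_succ, Finset.prod_range_succ]
    calc _ < (∏ i ∈ Finset.range m, q i) + (∏ i ∈ Finset.range m, q i) * rank (x.1 m) := by omega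
      _ = (∏ i ∈ Finset.range m, q i) * (rank (x.1 m) + 1) := by ring
      _ ≤ _ := Nat.mul_le_mul_left _ (hq.rank_lt _)

theorem height_of_isMax {m : ℕ} {x : B.PathSpace} (h : ∀ k < m, IsMax (x.1 k)) :
    height q m x + 1 = ∏ i ∈ Finset.range m, q i := by
  induction m with
  | zero => simp [height]
  | succ m ih =>
    rw [height_succ, Finset.prod_range_succ, ← hq.rank_of_isMax (h m (Nat.lt_succ_self m)), mul_add,
      mul_one, ← ih fun k hk => h k (by omega)]
    ring

/-- Uniqueness of mixed-radix digits: division by the last weight isolates the top digit, and the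
remainder is the previous height. -/
theorem rank_eq_of_height_eq {m : ℕ} {x y : B.PathSpace} (h : height q m x = height q m y) :
    ∀ k < m, rank (x.1 k) = rank (y.1 k) := by
  induction m with
  | zero => intro k hk; omega
  | succ m ih =>
    rw [height_succ, height_succ] at h
    have hx := hq.height_lt m x
    have hy := hq.height_lt m y
    have h1 := congrArg (· % ∏ i ∈ Finset.range m, q i) h
    have h2 := congrArg (· / ∏ i ∈ Finset.range m, q i) h
    simp only [Nat.add_mul_mod_self_left, Nat.mod_eq_of_lt hx, Nat.mod_eq_of_lt hy] at h1
    simp only [Nat.add_mul_div_left _ _ (Nat.zero_lt_of_lt hx), Nat.div_eq_of_lt hx,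
      Nat.div_eq_of_lt hy, zero_add] at h2
    intro k hk
    rcases Nat.eq_or_lt_of_le (Nat.le_of_lt_succ hk) with rfl | hlt
    · exact h2
    · exact ih h1 k hlt

/-- The height and the tower of level `m` determine the first `m` edges of a path. -/
theorem eq_of_height_eq_of_tower_eq {m : ℕ} {x y : B.PathSpace} (h : height q m x = height q m y)
    (ht : tower m x = tower m y) : ∀ k < m, x.1 k = y.1 k := by
  have hr := hq.rank_eq_of_height_eq h
  -- Descending from level `m`: the vertex at level `k + 1` fixes the end-point of edge `k`, and the
  -- rank then fixes the edge.
  have key : ∀ j k, k + j = m → tower k x = tower k y ∧ (k < m → x.1 k = y.1 k) := by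
    intro j
    induction j with
    | zero =>
      rintro k rfl
      exact ⟨ht, fun hk => absurd hk (lt_irrefl _)⟩
    | succ j ih =>
      intro k hk
      have : x.1 k = y.1 k := by
        refine eq_of_rank_eq ?_ (hr k (by omega))
        rw [x.2 k, y.2 k]
        exact (ih (k + 1) (by omega)).1
      exact ⟨by rw [tower, tower, this], fun _ => this⟩
  exact fun k hk => (key (m - k) k (by omega)).2 hk

/-- The Vershik rule is the odometer's addition of one with carry; the second case occurs when the
carry runs past the first `m` digits. -/
theorem height_of_vershikStep {x y : B.PathSpace} (h : VershikStep x y) (m : ℕ) :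
    (height q m y = height q m x + 1 ∧ tower m y = tower m x) ∨
      (height q m x + 1 = ∏ i ∈ Finset.range m, q i ∧ height q m y = 0) := by
  obtain ⟨n, hmax, -, hcov, hmin, htail⟩ := h
  rcases le_or_gt m n with hm | hm
  · exact Or.inr ⟨hq.height_of_isMax fun k hk => hmax k (by omega),
      height_eq_zero fun k hk => hmin k (by omega)⟩
  · refine Or.inl ⟨?_, by rw [tower, tower, htail m hm]⟩
    induction m, (show n + 1 ≤ m from hm) using Nat.le_induction with
    | base =>
      rw [height_succ, height_succ, height_eq_zero hmin, rank_of_covBy hcov, mul_add, mul_one,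
        ← hq.height_of_isMax hmax]
      ring
    | succ m hm' ih =>
      rw [height_succ, height_succ, ih hm', htail m hm']
      ring

/-- The Vershik map climbs the towers of level `m` by one step. -/
theorem height_vershikMap (hB : B.IsProperlyOrdered) (m : ℕ) (x : B.PathSpace) :
    (height q m (vershikMap hB x) = height q m x + 1 ∧ tower m (vershikMap hB x) = tower m x) ∨
      (height q m x + 1 = ∏ i ∈ Finset.range m, q i ∧ height q m (vershikMap hB x) = 0) := by
  classical
  by_cases hx : IsMaxPath x
  · rw [vershikMap, dif_pos hx]
    exact Or.inr ⟨hq.height_of_isMax fun k _ => hx k,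
      height_eq_zero fun k _ => hB.2.choose_spec.1 k⟩
  · rw [vershikMap, dif_neg hx]
    exact hq.height_of_vershikStep (existsUnique_vershikStep hx).choose_spec.1 m

end IsToeplitz

end OrderedBratteliDiagram

/-! ### Approximation by functions of finitely many edges -/

namespace OrderedBratteliDiagram

variable {B : OrderedBratteliDiagram} {q : ℕ → ℕ}

/-- The σ-algebra generated by the first `n` edges of a path. -/
@[reducible]
def prefixSigma (B : OrderedBratteliDiagram) (n : ℕ) : MeasurableSpace B.PathSpace :=
  ⨆ k, ⨆ _ : k < n, MeasurableSpace.comap (fun x : B.PathSpace => x.1 k) ⊤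

/-- A countable product of finite discrete spaces has its product σ-algebra as Borel σ-algebra, and
this restricts to paths. It lets martingale convergence reach every Borel function. -/
theorem iSup_prefixSigma :
    ⨆ n, B.prefixSigma n = (inferInstance : MeasurableSpace B.PathSpace) := by
  have h1 : (inferInstance : MeasurableSpace B.PathSpace) =
      ⨆ k, MeasurableSpace.comap (fun x : B.PathSpace => x.1 k) ⊤ := by
    let _ (k : ℕ) : TopologicalSpace (B.E k) := ⊥
    let _ (k : ℕ) : MeasurableSpace (B.E k) := ⊤
    have _ (k : ℕ) : DiscreteTopology (B.E k) := ⟨rfl⟩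
    have h2 : borel (∀ k, B.E k) = MeasurableSpace.pi :=
      (BorelSpace.measurable_eq (α := ∀ k, B.E k)).symm
    change @borel _ (TopologicalSpace.induced Subtype.val Pi.topologicalSpace) = _
    rw [borel_comap, h2, MeasurableSpace.pi, MeasurableSpace.comap_iSup]
    simp only [MeasurableSpace.comap_comp]
    rfl
  rw [h1]
  refine le_antisymm (iSup_le fun n => iSup_le fun k => iSup_le fun _ => le_iSup_of_le k le_rfl)
    (iSup_le fun k => ?_)
  exact le_iSup_of_le (k + 1) (le_iSup_of_le k (le_iSup_of_le (Nat.lt_succ_self k) le_rfl))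

/-- The filtration of the initial segments of paths. -/
def prefixFiltration (B : OrderedBratteliDiagram) :
    Filtration ℕ (inferInstance : MeasurableSpace B.PathSpace) where
  seq := B.prefixSigma
  mono' _ _ hnm := iSup_mono fun _ => iSup_le fun hk => le_iSup_of_le (hk.trans_le hnm) le_rfl
  le' n := iSup_prefixSigma (B := B) ▸ le_iSup B.prefixSigma n

theorem measurableSet_edge (n : ℕ) (s : Set (B.E n)) :
    MeasurableSet {x : B.PathSpace | x.1 n ∈ s} := by
  refine B.prefixFiltration.le (n + 1) _ ?_
  have h : MeasurableSpace.comap (fun x : B.PathSpace => x.1 n) ⊤ ≤ B.prefixSigma (n + 1) :=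
    le_iSup_of_le n (le_iSup_of_le (Nat.lt_succ_self n) le_rfl)
  exact h _ ⟨s, trivial, rfl⟩

theorem measurableSet_tower (n : ℕ) (s : Set (B.V n)) :
    MeasurableSet {x : B.PathSpace | tower n x ∈ s} :=
  measurableSet_edge n (B.src n ⁻¹' s)

theorem measurable_height (m : ℕ) : Measurable (height q m : B.PathSpace → ℕ) := by
  refine Finset.measurable_fun_sum _ fun k _ => Measurable.const_mul ?_ _
  exact fun s _ => measurableSet_edge k (rank ⁻¹' s)

theorem measurable_height_tower {α : Type*} [MeasurableSpace α] (m : ℕ) (F : ℕ → B.V m → α) :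
    Measurable fun x : B.PathSpace => F (height q m x) (tower m x) := by
  let _ : MeasurableSpace (B.V m) := ⊤
  have ht : Measurable (tower m : B.PathSpace → B.V m) := fun s _ => measurableSet_tower m s
  exact (Measurable.of_discrete (f := Function.uncurry F)).comp ((measurable_height m).prodMk ht)

namespace IsToeplitz

variable (hq : B.IsToeplitz q)
include hq

theorem factorsThrough_of_measurable {m : ℕ} {f : B.PathSpace → ℝ}
    (hf : StronglyMeasurable[B.prefixSigma m] f) :
    f.FactorsThrough fun x => (height q m x, tower m x) := by
  let r : B.PathSpace → ∀ k : Fin m, B.E k := fun x k => x.1 k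
  have hle : B.prefixSigma m ≤ MeasurableSpace.comap r ⊤ := by
    refine iSup_le fun k => iSup_le fun hk => ?_
    rintro _ ⟨s, -, rfl⟩
    exact ⟨{z | z ⟨k, hk⟩ ∈ s}, trivial, rfl⟩
  have h1 : f.FactorsThrough r := @StronglyMeasurable.factorsThrough _ _ _ ⊤ r f _ _ _ (hf.mono hle)
  intro x y hxy
  have h2 := Prod.ext_iff.1 hxy
  exact h1 (funext fun k => hq.eq_of_height_eq_of_tower_eq h2.1 h2.2 k k.2)

/-- An integrable function is approximated in mean by functions of the height and the tower. -/
theorem eventually_exists_approx {μ : Measure B.PathSpace} [IsFiniteMeasure μ]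
    {f : B.PathSpace → ℂ} (hfm : Measurable f) (hf : Integrable f μ) {ε : ℝ≥0∞} (hε : 0 < ε) :
    ∀ᶠ m in atTop, ∃ Φ : ℕ → B.V m → ℂ,
      ∫⁻ x, ‖f x - Φ (height q m x) (tower m x)‖ₑ ∂μ ≤ ε := by
  have key : ∀ g : B.PathSpace → ℝ, Measurable g → Integrable g μ → ∀ᶠ m in atTop,
      ∃ Φ : ℕ → B.V m → ℝ, ∫⁻ x, ‖g x - Φ (height q m x) (tower m x)‖ₑ ∂μ ≤ ε / 2 := by
    intro g hgm hg
    have hgs : StronglyMeasurable[⨆ n, B.prefixFiltration n] g := by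
      have : ⨆ n, B.prefixFiltration n = (inferInstance : MeasurableSpace B.PathSpace) :=
        iSup_prefixSigma
      rw [this]
      exact hgm.stronglyMeasurable
    -- Lévy's upward theorem in mean; the conditional expectation depends only on the first `m`
    -- edges, that is, on height and tower.
    have ht := hg.tendsto_eLpNorm_condExp (ℱ := B.prefixFiltration) hgs
    filter_upwards [(tendsto_order.1 ht).2 _ (ENNReal.half_pos hε.ne')] with m hm
    have hfac := hq.factorsThrough_of_measurable (m := m) (f := μ[g|B.prefixFiltration m])
      stronglyMeasurable_condExp
    refine ⟨fun j t => Function.extend (fun x : B.PathSpace => (height q m x, tower m x))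
      (μ[g|B.prefixFiltration m]) 0 (j, t), ?_⟩
    refine le_trans (le_of_eq ?_) hm.le
    rw [eLpNorm_one_eq_lintegral_enorm]
    refine lintegral_congr fun x => ?_
    have h := hfac.extend_apply 0 x
    dsimp only at h ⊢
    rw [h, Pi.sub_apply, ← enorm_neg, neg_sub]
  filter_upwards [key _ (Complex.measurable_re.comp hfm) hf.re,
    key _ (Complex.measurable_im.comp hfm) hf.im] with m ⟨Φ, hΦ⟩ ⟨Ψ, hΨ⟩
  refine ⟨fun j t => Φ j t + Ψ j t * Complex.I, ?_⟩
  have hsum := add_le_add hΦ hΨ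
  rw [ENNReal.add_halves] at hsum
  have hmeas : Measurable fun x => ‖(Complex.re ∘ f) x - Φ (height q m x) (tower m x)‖ₑ :=
    ((Complex.measurable_re.comp hfm).sub (measurable_height_tower m Φ)).enorm
  rw [← lintegral_add_left hmeas] at hsum
  refine le_trans (lintegral_mono fun x => ?_) hsum
  have : f x - (Φ (height q m x) (tower m x) + Ψ (height q m x) (tower m x) * Complex.I) =
      ((f x).re - Φ (height q m x) (tower m x) : ℝ) +
        ((f x).im - Ψ (height q m x) (tower m x) : ℝ) * Complex.I := by
    conv_lhs => rw [← Complex.re_add_im (f x)]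
    push_cast
    ring
  rw [this]
  refine (enorm_add_le _ _).trans (le_of_eq ?_)
  rw [enorm_mul]
  simp only [Function.comp, ← ofReal_norm, Complex.norm_real, Complex.norm_I, ENNReal.ofReal_one,
    mul_one]

end IsToeplitz

end OrderedBratteliDiagram

/-! ### Unimodular eigenfunctions and separation of roots of unity -/

/-- The modulus of an eigenfunction is invariant, hence almost everywhere a nonzero constant by
which one can divide. The value `1` on the exceptional null set makes the modulus `1` everywhere. -/
theorem exists_unimodular_eigenfunction {X : Type*} [MeasurableSpace X] {T : X → X}
    {μ : Measure X} (hT : Ergodic T μ) {l : ℂ} (hl : ‖l‖ = 1)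
    (h : IsMeasurableEigenvalue T μ l) :
    ∃ f : X → ℂ, Measurable f ∧ (∀ x, ‖f x‖ = 1) ∧ ∀ᵐ x ∂μ, f (T x) = l * f x := by
  classical
  obtain ⟨f, hf, hf0, hfT⟩ := h
  set g := hf.1.mk f
  have hgm : Measurable g := hf.1.stronglyMeasurable_mk.measurable
  have hgT : ∀ᵐ x ∂μ, g (T x) = l * g x := by
    filter_upwards [hfT, hf.1.ae_eq_mk,
      hT.toMeasurePreserving.quasiMeasurePreserving.ae hf.1.ae_eq_mk] with x h1 h2 h3
    exact h3.symm.trans (h1.trans (congrArg (l * ·) h2))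
  obtain ⟨r, hr⟩ := hT.ae_eq_const_of_ae_eq_comp_ae (g := fun x => ‖g x‖)
    hgm.norm.aestronglyMeasurable (by
      filter_upwards [hgT] with x hx
      simp [hx, hl])
  have hr0 : r ≠ 0 := by
    rintro rfl
    refine hf0 ?_
    filter_upwards [hr, hf.1.ae_eq_mk] with x h1 h2
    rw [h2]
    exact norm_eq_zero.1 h1
  refine ⟨fun x => if ‖g x‖ = r then g x / r else 1,
    Measurable.ite (measurableSet_eq_fun hgm.norm measurable_const) (hgm.div_const _)
      measurable_const, fun x => ?_, ?_⟩
  · dsimp only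
    split_ifs with hx
    · have : 0 ≤ r := hx ▸ norm_nonneg _
      rw [norm_div, hx, Complex.norm_real, Real.norm_of_nonneg this, div_self hr0]
    · exact norm_one
  · filter_upwards [hr, hT.toMeasurePreserving.quasiMeasurePreserving.ae hr, hgT] with x h1 h2 h3
    simp only [Function.const_apply] at h1 h2
    rw [if_pos h1, if_pos h2, h3, mul_div_assoc]

theorem isMeasurableEigenvalue_of_unimodular {X : Type*} [MeasurableSpace X] {T : X → X}
    {μ : Measure X} [IsProbabilityMeasure μ] {l : ℂ} {f : X → ℂ} (hf : Measurable f)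
    (hf1 : ∀ x, ‖f x‖ = 1) (hfT : ∀ᵐ x ∂μ, f (T x) = l * f x) : IsMeasurableEigenvalue T μ l := by
  refine ⟨f, MemLp.of_bound hf.aestronglyMeasurable 1 (ae_of_all _ fun x => (hf1 x).le),
    fun h => ?_, hfT⟩
  obtain ⟨x, hx⟩ := h.exists
  have := hf1 x
  rw [hx] at this
  simp at this

/-- A unimodular function whose `c`-th power is constant and which is rotated by a primitive `c`-th
root of unity takes its `c` values with the same probability. -/
theorem exists_one_le_mul_measure_eq {X : Type*} [MeasurableSpace X] {S : X → X}
    {μ : Measure X} [IsProbabilityMeasure μ] (hS : MeasurePreserving S μ μ) {c : ℕ} (hc : 0 < c)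
    {ζ κ : ℂ} (hζ : IsPrimitiveRoot ζ c) {g : X → ℂ} (hg : Measurable g) (hg1 : ∀ x, ‖g x‖ = 1)
    (hgc : ∀ᵐ x ∂μ, g x ^ c = κ) (hgS : ∀ᵐ x ∂μ, g (S x) = ζ * g x) :
    ∃ w : ℂ, ‖w‖ = 1 ∧ ∀ k : ℕ, 1 ≤ c * μ {x | g x = ζ ^ k * w} := by
  obtain ⟨x₀, hx₀⟩ := hgc.exists
  have hw : g x₀ ≠ 0 := norm_ne_zero_iff.1 (by rw [hg1]; exact one_ne_zero)
  refine ⟨g x₀, hg1 x₀, ?_⟩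
  -- Up to a null set, `S` pulls the fibre of exponent `k + 1` back to that of exponent `k`.
  have hconst : ∀ k : ℕ, μ {x | g x = ζ ^ k * g x₀} = μ {x | g x = g x₀} := by
    intro k
    induction k with
    | zero => simp
    | succ k ih =>
      rw [← ih, ← hS.measure_preimage
        (measurableSet_eq_fun hg measurable_const).nullMeasurableSet]
      refine measure_congr ?_
      filter_upwards [hgS] with x hx
      refine propext ?_
      change g (S x) = _ ↔ g x = _
      rw [hx, pow_succ', mul_assoc]
      exact mul_right_inj' (hζ.ne_zero hc.ne')
  have hcover : μ (⋃ k ∈ Finset.range c, {x | g x = ζ ^ k * g x₀}) = 1 := by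
    rw [← measure_univ (μ := μ)]
    refine measure_congr (eventuallyEq_univ.2 ?_)
    filter_upwards [hgc] with x hx
    have h1 : (g x / g x₀) ^ c = 1 := by
      rw [div_pow, hx, hx₀, div_self]
      rw [← hx₀]
      exact pow_ne_zero _ hw
    have : NeZero c := ⟨hc.ne'⟩
    obtain ⟨k, hk, hk'⟩ := hζ.eq_pow_of_pow_eq_one h1
    refine Set.mem_iUnion₂.2 ⟨k, Finset.mem_range.2 hk, ?_⟩
    change g x = _
    rw [hk', div_mul_cancel₀ _ hw]
  intro k
  rw [← hcover]
  refine (measure_biUnion_finset_le _ _).trans (le_of_eq ?_)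
  simp [hconst]

theorem exists_separation_rootsOfUnity (c : ℕ) (hc : 0 < c) :
    ∃ r : ℝ, 0 < r ∧ ∀ ω : ℂ, ω ^ c = 1 → ω ≠ 1 → 2 * r ≤ ‖ω - 1‖ := by
  have hfin : {ω : ℂ | ω ^ c = 1 ∧ ω ≠ 1}.Finite :=
    ((Polynomial.nthRoots c (1 : ℂ)).toFinset.finite_toSet).subset fun ω hω => by
      simpa [Polynomial.mem_nthRoots hc] using hω.1
  have h1 : (1 : ℂ) ∈ {ω : ℂ | ω ^ c = 1 ∧ ω ≠ 1}ᶜ := fun h => h.2 rfl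
  obtain ⟨ε, hε, hsub⟩ := Metric.isOpen_iff.1 hfin.isClosed.isOpen_compl _ h1
  refine ⟨ε / 2, by positivity, fun ω hω hω1 => ?_⟩
  by_contra! hlt
  exact hsub (show ω ∈ Metric.ball 1 ε by rw [mem_ball_iff_norm]; linarith) ⟨hω, hω1⟩

/-- Fewer than `c` points cannot be close to all points of a rotated group of `c`-th roots of
unity. -/
theorem exists_pow_mul_far {ι : Type*} {c : ℕ} {r : ℝ}
    (hr : ∀ ω : ℂ, ω ^ c = 1 → ω ≠ 1 → 2 * r ≤ ‖ω - 1‖) {ζ : ℂ} (hζ : IsPrimitiveRoot ζ c)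
    {w : ℂ} (hw : ‖w‖ = 1) (I : Finset ι) (hI : I.card < c) (w₀ : ι → ℂ) :
    ∃ k : ℕ, ∀ t ∈ I, r ≤ ‖ζ ^ k * w - w₀ t‖ := by
  by_contra! h
  choose t ht htr using h
  -- Pigeonhole: two of the `c` points would lie within `r` of the same `w₀ t`, although they are `2
  -- * r` apart.
  obtain ⟨j, hj, k, hk, hjk, heq⟩ := Finset.exists_ne_map_eq_of_card_lt_of_maps_to
    (s := Finset.range c) (t := I) (by simpa using hI) (f := t) fun k _ => ht k
  have hζ0 : ζ ≠ 0 := hζ.ne_zero (by omega)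
  have hζ1 : ‖ζ‖ = 1 := hζ.norm'_eq_one (by omega)
  have h1 : 2 * r ≤ ‖ζ ^ j / ζ ^ k - 1‖ := by
    refine hr _ ?_ fun h => hjk ?_
    · rw [div_pow, ← pow_mul, ← pow_mul, mul_comm j, mul_comm k, pow_mul, pow_mul, hζ.pow_eq_one]
      simp
    · refine hζ.pow_inj (Finset.mem_range.1 hj) (Finset.mem_range.1 hk) ?_
      rwa [div_eq_one_iff_eq (pow_ne_zero _ hζ0)] at h
  have h2 : ‖ζ ^ j / ζ ^ k - 1‖ = ‖ζ ^ j * w - ζ ^ k * w‖ := by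
    rw [div_sub_one (pow_ne_zero _ hζ0), norm_div, norm_pow, hζ1, one_pow, div_one, ← sub_mul,
      norm_mul, hw, mul_one]
  have h3 : ‖ζ ^ j * w - ζ ^ k * w‖ ≤ ‖ζ ^ j * w - w₀ (t j)‖ + ‖ζ ^ k * w - w₀ (t k)‖ := by
    rw [heq, norm_sub_rev (ζ ^ k * w)]
    exact norm_sub_le_norm_sub_add_norm_sub _ _ _
  linarith [htr j, htr k]

/-! ### Functions invariant along the towers -/

namespace OrderedBratteliDiagram

variable {B : OrderedBratteliDiagram} {q : ℕ → ℕ}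

namespace IsToeplitz

variable (hq : B.IsToeplitz q) (hB : B.IsProperlyOrdered)
include hq

/-- Heights grow by one modulo `p_m` and stay below `p_m`. Hence the factor `l ^ (-height)` is
unchanged by `T ^ p_m`. -/
theorem height_iterate_vershikMap (m : ℕ) (x : B.PathSpace) :
    height q m ((vershikMap hB)^[∏ i ∈ Finset.range m, q i] x) = height q m x := by
  have h1 : ∀ k, height q m ((vershikMap hB)^[k] x) ≡ height q m x + k
      [MOD ∏ i ∈ Finset.range m, q i] := by
    intro k
    induction k with
    | zero => rfl
    | succ k ih =>
      rw [Function.iterate_succ_apply', ← add_assoc]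
      refine Nat.ModEq.trans ?_ (ih.add_right 1)
      rcases hq.height_vershikMap hB m ((vershikMap hB)^[k] x) with h | h
      · rw [h.1]
      · rw [h.1, h.2]
        exact ((Nat.modEq_zero_iff_dvd).2 dvd_rfl).symm
  have h2 := h1 (∏ i ∈ Finset.range m, q i)
  rw [Nat.ModEq, Nat.add_mod_right] at h2
  rwa [Nat.mod_eq_of_lt (hq.height_lt m _), Nat.mod_eq_of_lt (hq.height_lt m _)] at h2

/-- All levels of a tower carry the same distribution of a function that is invariant along the
tower. -/
theorem setLIntegral_level {μ : Measure B.PathSpace}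
    (hT : MeasurePreserving (vershikMap hB) μ μ) {m : ℕ} {u : B.PathSpace → ℝ≥0∞}
    (hu : Measurable u)
    (huT : ∀ᵐ x ∂μ, height q m (vershikMap hB x) = height q m x + 1 → u (vershikMap hB x) = u x)
    (t : B.V m) {j : ℕ} (hj : j < ∏ i ∈ Finset.range m, q i) :
    ∫⁻ x in {x | height q m x = j ∧ tower m x = t}, u x ∂μ =
      ∫⁻ x in {x | height q m x = 0 ∧ tower m x = t}, u x ∂μ := by
  have hmeas : ∀ j, MeasurableSet {x : B.PathSpace | height q m x = j ∧ tower m x = t} := fun j =>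
    ((measurable_height m) (measurableSet_singleton j)).inter (measurableSet_tower m {t})
  induction j with
  | zero => rfl
  | succ j ih =>
    rw [← ih (by omega), ← hT.setLIntegral_comp_preimage (hmeas _) hu]
    have hpre : vershikMap hB ⁻¹' {x | height q m x = j + 1 ∧ tower m x = t} =
        {x | height q m x = j ∧ tower m x = t} := by
      ext x
      simp only [Set.mem_preimage, Set.mem_ofPred_eq]
      rcases hq.height_vershikMap hB m x with h | h
      · rw [h.1, h.2, Nat.add_right_cancel_iff]
      · rw [h.2]
        exact ⟨fun h' => by omega, fun h' => by omega⟩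
    rw [hpre]
    refine setLIntegral_congr_fun_ae (hmeas j) ?_
    filter_upwards [huT] with x hx hxj
    refine hx ?_
    rcases hq.height_vershikMap hB m x with h | h
    · exact h.1
    · have := hxj.1
      omega

theorem lintegral_eq_sum_levels [∀ n, Fintype (B.V n)] {μ : Measure B.PathSpace} (m : ℕ)
    (u : B.PathSpace → ℝ≥0∞) :
    ∫⁻ x, u x ∂μ = ∑ t, ∑ j ∈ Finset.range (∏ i ∈ Finset.range m, q i),
      ∫⁻ x in {x | height q m x = j ∧ tower m x = t}, u x ∂μ := by
  have hmeas : ∀ i : ℕ × B.V m,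
      MeasurableSet {x : B.PathSpace | height q m x = i.1 ∧ tower m x = i.2} := fun i =>
    ((measurable_height m) (measurableSet_singleton i.1)).inter (measurableSet_tower m {i.2})
  rw [← Finset.sum_product_right' (Finset.range (∏ i ∈ Finset.range m, q i)) Finset.univ
    fun j t => ∫⁻ x in {x | height q m x = j ∧ tower m x = t}, u x ∂μ,
    ← lintegral_biUnion_finset (s := Finset.range (∏ i ∈ Finset.range m, q i) ×ˢ Finset.univ)
      (t := fun i : ℕ × B.V m => {x | height q m x = i.1 ∧ tower m x = i.2}),
    ← setLIntegral_univ]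
  · congr 2
    refine (Set.eq_univ_of_forall fun x => ?_).symm
    exact Set.mem_iUnion₂.2 ⟨(height q m x, tower m x), by simp [hq.height_lt m x], rfl, rfl⟩
  · intro i _ j _ hij
    refine Set.disjoint_left.2 fun x hi hj => hij ?_
    exact Prod.ext (hi.1.symm.trans hj.1) (hi.2.symm.trans hj.2)
  · exact fun i _ => hmeas i

/-- A function invariant along the towers that is close to a function of the height and the tower is
as close to a function of the tower. -/
theorem exists_tower_approx {μ : Measure B.PathSpace}
    (hT : MeasurePreserving (vershikMap hB) μ μ) {m : ℕ} {g : B.PathSpace → ℂ}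
    (hg : Measurable g)
    (hgT : ∀ᵐ x ∂μ, height q m (vershikMap hB x) = height q m x + 1 → g (vershikMap hB x) = g x)
    (Ψ : ℕ → B.V m → ℂ) :
    ∃ w₀ : B.V m → ℂ, ∫⁻ x, ‖g x - w₀ (tower m x)‖ₑ ∂μ ≤
      ∫⁻ x, ‖g x - Ψ (height q m x) (tower m x)‖ₑ ∂μ := by
  classical
  have : ∀ n, Fintype (B.V n) := fun n => Fintype.ofFinite _
  have hlevel : ∀ (t : B.V m) (w : ℂ), ∀ j ∈ Finset.range (∏ i ∈ Finset.range m, q i),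
      ∫⁻ x in {x | height q m x = j ∧ tower m x = t}, ‖g x - w‖ₑ ∂μ =
        ∫⁻ x in {x | height q m x = 0 ∧ tower m x = t}, ‖g x - w‖ₑ ∂μ := by
    intro t w j hj
    refine hq.setLIntegral_level hB hT (hg.sub_const w).enorm ?_ t (Finset.mem_range.1 hj)
    filter_upwards [hgT] with x hx h
    rw [hx h]
  -- In each tower `w` is the `Ψ j t` of the best floor `j`; as all floors carry the same
  -- distribution of `g`, this value does at least as well on every floor.
  have hmin : ∀ t : B.V m, ∃ w : ℂ, ∀ j ∈ Finset.range (∏ i ∈ Finset.range m, q i),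
      ∫⁻ x in {x | height q m x = 0 ∧ tower m x = t}, ‖g x - w‖ₑ ∂μ ≤
        ∫⁻ x in {x | height q m x = 0 ∧ tower m x = t}, ‖g x - Ψ j t‖ₑ ∂μ := by
    intro t
    rcases (Finset.range (∏ i ∈ Finset.range m, q i)).eq_empty_or_nonempty with h | h
    · exact ⟨0, by simp [h]⟩
    · obtain ⟨j, -, hj⟩ := Finset.exists_min_image _ (fun j =>
        ∫⁻ x in {x | height q m x = 0 ∧ tower m x = t}, ‖g x - Ψ j t‖ₑ ∂μ) h
      exact ⟨Ψ j t, hj⟩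
  choose w₀ hw₀ using hmin
  have hmeas : ∀ (j : ℕ) (t : B.V m),
      MeasurableSet {x : B.PathSpace | height q m x = j ∧ tower m x = t} := fun j t =>
    ((measurable_height m) (measurableSet_singleton j)).inter (measurableSet_tower m {t})
  refine ⟨w₀, ?_⟩
  rw [hq.lintegral_eq_sum_levels m, hq.lintegral_eq_sum_levels m]
  refine Finset.sum_le_sum fun t _ => Finset.sum_le_sum fun j hj => ?_
  calc _ = ∫⁻ x in {x | height q m x = j ∧ tower m x = t}, ‖g x - w₀ t‖ₑ ∂μ :=
        setLIntegral_congr_fun (hmeas j t) fun x hx => by rw [hx.2]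
    _ ≤ ∫⁻ x in {x | height q m x = j ∧ tower m x = t}, ‖g x - Ψ j t‖ₑ ∂μ := by
        rw [hlevel t _ j hj, hlevel t _ j hj]
        exact hw₀ t j hj
    _ = _ := setLIntegral_congr_fun (hmeas j t) fun x hx => by rw [hx.1, hx.2]

end IsToeplitz

end OrderedBratteliDiagram

/-! ### The bound by the number of towers of non-vanishing mass -/

namespace OrderedBratteliDiagram

variable {B : OrderedBratteliDiagram} {q : ℕ → ℕ}

namespace IsToeplitz

variable (hq : B.IsToeplitz q) (hB : B.IsProperlyOrdered)
include hq

/-- A value of the untwisted eigenfunction far from every `w₀ t` with `t ∈ I` has mass at least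
`1/c`, yet is attained only where the approximation fails by `r` or the tower is outside `I`. Once
both errors are small the inequality is absurd. -/
theorem one_le_of_card_lt {μ : Measure B.PathSpace} [IsProbabilityMeasure μ]
    (hT : Ergodic (vershikMap hB) μ) {l : ℂ} (hl : ‖l‖ = 1) {f : B.PathSpace → ℂ}
    (hf : Measurable f) (hf1 : ∀ x, ‖f x‖ = 1) (hfT : ∀ᵐ x ∂μ, f (vershikMap hB x) = l * f x)
    {m c : ℕ} (hc : 0 < c) (hζ : IsPrimitiveRoot (l ^ ∏ i ∈ Finset.range m, q i) c) {r : ℝ}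
    (hr0 : 0 < r) (hr : ∀ ω : ℂ, ω ^ c = 1 → ω ≠ 1 → 2 * r ≤ ‖ω - 1‖) {ε : ℝ≥0∞}
    {Φ : ℕ → B.V m → ℂ} (hΦ : ∫⁻ x, ‖f x - Φ (height q m x) (tower m x)‖ₑ ∂μ ≤ ε)
    {I : Finset (B.V m)} (hI : I.card < c) :
    1 ≤ c * (ε / ENNReal.ofReal r + μ {x | tower m x ∉ I}) := by
  have hl0 : l ≠ 0 := norm_ne_zero_iff.1 (by rw [hl]; exact one_ne_zero)
  set p := ∏ i ∈ Finset.range m, q i with hp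
  set g : B.PathSpace → ℂ := fun x => (l ^ height q m x)⁻¹ * f x with hgdef
  have hg : Measurable g := (measurable_height_tower m fun j _ => (l ^ j)⁻¹).mul hf
  have hg1 : ∀ x, ‖g x‖ = 1 := fun x => by simp [hgdef, hl, hf1]
  have hgup : ∀ᵐ x ∂μ, height q m (vershikMap hB x) = height q m x + 1 →
      g (vershikMap hB x) = g x := by
    filter_upwards [hfT] with x hx h
    simp only [hgdef, hx, h, pow_succ]
    field_simp
  have hgwrap : ∀ᵐ x ∂μ, height q m x + 1 = p ∧ height q m (vershikMap hB x) = 0 →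
      g (vershikMap hB x) = l ^ p * g x := by
    filter_upwards [hfT] with x hx h
    simp only [hgdef, hx, h.2, ← h.1, pow_succ]
    field_simp
  -- The jump `l ^ p` at the top of a tower disappears in the `c`-th power.
  obtain ⟨κ, hκ⟩ := hT.ae_eq_const_of_ae_eq_comp_ae (g := fun x => g x ^ c)
    (hg.pow_const c).aestronglyMeasurable (by
      filter_upwards [hgup, hgwrap] with x h1 h2
      simp only [Function.comp]
      rcases hq.height_vershikMap hB m x with h | h
      · rw [h1 h.1]
      · rw [h2 h, mul_pow, hζ.pow_eq_one, one_mul])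
  have hfiter : ∀ k : ℕ, ∀ᵐ x ∂μ, f ((vershikMap hB)^[k] x) = l ^ k * f x := by
    intro k
    induction k with
    | zero => simp
    | succ k ih =>
      filter_upwards [ih, (hT.toMeasurePreserving.iterate k).quasiMeasurePreserving.ae hfT]
        with x h1 h2
      rw [Function.iterate_succ_apply', h2, h1, pow_succ']
      ring
  have hgS : ∀ᵐ x ∂μ, g ((vershikMap hB)^[p] x) = l ^ p * g x := by
    filter_upwards [hfiter p] with x hx
    have h := hq.height_iterate_vershikMap hB m x
    rw [← hp] at h
    simp only [hgdef, hx, h]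
    ring
  obtain ⟨w, hw, hmass⟩ := exists_one_le_mul_measure_eq (hT.toMeasurePreserving.iterate p) hc hζ
    hg hg1 hκ hgS
  obtain ⟨w₀, hw₀⟩ := hq.exists_tower_approx hB hT.toMeasurePreserving hg hgup
    fun j t => (l ^ j)⁻¹ * Φ j t
  have hw₀' : ∫⁻ x, ‖g x - w₀ (tower m x)‖ₑ ∂μ ≤ ε := by
    refine hw₀.trans (le_trans (le_of_eq ?_) hΦ)
    refine lintegral_congr fun x => ?_
    simp only [hgdef]
    rw [← mul_sub, enorm_mul, ← ofReal_norm, norm_inv, norm_pow, hl]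
    simp
  obtain ⟨k, hk⟩ := exists_pow_mul_far hr hζ hw I hI w₀
  refine (hmass k).trans (mul_le_mul_right ?_ _)
  -- Markov's inequality.
  have hmark : μ {x | ENNReal.ofReal r ≤ ‖g x - w₀ (tower m x)‖ₑ} ≤ ε / ENNReal.ofReal r :=
    (meas_ge_le_lintegral_div (hg.sub (measurable_height_tower (q := q) m
      fun _ t => w₀ t)).enorm.aemeasurable (by simpa using hr0) ENNReal.ofReal_ne_top).trans
      (ENNReal.div_le_div_right hw₀' _)
  refine le_trans (measure_mono ?_) ((measure_union_le _ _).trans (add_le_add_left hmark _))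
  intro x hx
  by_cases ht : tower m x ∈ I
  · refine Or.inl ?_
    change ENNReal.ofReal r ≤ _
    rw [← ofReal_norm, show g x = _ from hx]
    exact ENNReal.ofReal_le_ofReal (hk _ ht)
  · exact Or.inr ht

/-- If `exp (2iπ/b)` is an eigenvalue for `μ`, then the limit of `b / gcd (b, p_m)` is at most the
number of towers whose measure does not vanish in the limit. -/
theorem limit_le_card {μ : Measure B.PathSpace} [IsProbabilityMeasure μ]
    (hT : Ergodic (vershikMap hB) μ) {d : ℕ} (lab : ∀ n, B.V (n + 2) ≃ Fin d)
    {I : Finset (Fin d)} (hI : ∀ t ∉ I,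
      Tendsto (fun n => μ.real {x | lab n (tower (n + 2) x) = t}) atTop (𝓝 0))
    {b : ℕ} (hb : 0 < b)
    (hev : IsMeasurableEigenvalue (vershikMap hB) μ (Complex.exp (2 * Complex.I * Real.pi / b)))
    {c : ℕ} (hlim : Tendsto (fun m => b / Nat.gcd b (∏ i ∈ Finset.range m, q i)) atTop (𝓝 c)) :
    c ≤ I.card := by
  by_contra! hlt
  have hc : 0 < c := by omega
  have hprim : IsPrimitiveRoot (Complex.exp (2 * Complex.I * Real.pi / b)) b := by
    have h := Complex.isPrimitiveRoot_exp b hb.ne'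
    rwa [show 2 * (Real.pi : ℂ) * Complex.I / b = 2 * Complex.I * Real.pi / b by ring] at h
  set l := Complex.exp (2 * Complex.I * Real.pi / b)
  have hl : ‖l‖ = 1 := hprim.norm'_eq_one hb.ne'
  obtain ⟨f, hf, hf1, hfT⟩ := exists_unimodular_eigenfunction hT hl hev
  have hfi : Integrable f μ :=
    Integrable.of_bound hf.aestronglyMeasurable 1 (ae_of_all _ fun x => (hf1 x).le)
  obtain ⟨r, hr0, hr⟩ := exists_separation_rootsOfUnity c hc
  have hc' : (c : ℝ) ≠ 0 := by exact_mod_cast hc.ne'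
  -- With this `ε`, the term `c * (ε / r)` is `1/2`; the mass outside `I` must then contribute less
  -- than `1/2`.
  have hε : 0 < ENNReal.ofReal (r / (2 * c)) := by
    rw [ENNReal.ofReal_pos]
    positivity
  have happrox := (tendsto_add_atTop_iff_nat 2).2 tendsto_id |>.eventually
    (hq.eventually_exists_approx hf hfi hε)
  have hlim' : ∀ᶠ m in atTop, b / Nat.gcd b (∏ i ∈ Finset.range (m + 2), q i) = c := by
    rw [nhds_discrete, tendsto_pure] at hlim
    exact ((tendsto_add_atTop_iff_nat 2).2 tendsto_id).eventually hlim
  have hsmall : Tendsto (fun n => (c : ℝ≥0∞) * ∑ t ∈ Iᶜ, μ {x | lab n (tower (n + 2) x) = t}) atTop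
      (𝓝 0) := by
    have h1 : Tendsto (fun n => ∑ t ∈ Iᶜ, μ {x | lab n (tower (n + 2) x) = t}) atTop (𝓝 0) := by
      rw [show (0 : ℝ≥0∞) = ∑ t ∈ Iᶜ, 0 by simp]
      refine tendsto_finsetSum _ fun t ht => ?_
      have h2 := ENNReal.tendsto_ofReal (hI t (Finset.mem_compl.1 ht))
      simpa using h2
    simpa using ENNReal.Tendsto.const_mul h1 (Or.inr (ENNReal.natCast_ne_top c))
  obtain ⟨n, ⟨Φ, hΦ⟩, hn, hsm⟩ := (happrox.and (hlim'.and
    ((tendsto_order.1 hsmall).2 (ENNReal.ofReal (1 / 2)) (by simp)))).exists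
  -- The order of `l ^ p` is `b / gcd (b, p)`, which has already reached its limit `c`.
  have hζ : IsPrimitiveRoot (l ^ ∏ i ∈ Finset.range (n + 2), q i) c := by
    rw [← hn]
    have h := IsPrimitiveRoot.orderOf (l ^ ∏ i ∈ Finset.range (n + 2), q i)
    have hp : ∏ i ∈ Finset.range (n + 2), q i ≠ 0 := by
      obtain ⟨x⟩ : Nonempty B.PathSpace := nonempty_of_isProbabilityMeasure μ
      exact (Nat.zero_lt_of_lt (hq.height_lt (n + 2) x)).ne'
    rwa [orderOf_pow' _ hp, ← hprim.eq_orderOf] at h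
  have key := hq.one_le_of_card_lt hB hT hl hf hf1 hfT hc hζ hr0 hr hΦ
    (I := I.map (lab n).symm.toEmbedding) (by rwa [Finset.card_map])
  have h1 : μ {x | tower (n + 2) x ∉ I.map (lab n).symm.toEmbedding} ≤
      ∑ t ∈ Iᶜ, μ {x | lab n (tower (n + 2) x) = t} := by
    refine le_trans (measure_mono fun x hx => ?_) (measure_biUnion_finset_le _ _)
    refine Set.mem_iUnion₂.2 ⟨lab n (tower (n + 2) x), ?_, rfl⟩
    rw [Finset.mem_compl]
    refine fun h => hx ?_
    exact Finset.mem_map.2 ⟨_, h, by simp⟩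
  have h2 : (c : ℝ≥0∞) * (ENNReal.ofReal (r / (2 * c)) / ENNReal.ofReal r) =
      ENNReal.ofReal (1 / 2) := by
    rw [← ENNReal.ofReal_div_of_pos hr0, ← ENNReal.ofReal_natCast c,
      ← ENNReal.ofReal_mul (by positivity)]
    congr 1
    field_simp
  have h3 : (1 : ℝ≥0∞) < 1 := by
    calc (1 : ℝ≥0∞) ≤ _ := key
      _ ≤ c * (ENNReal.ofReal (r / (2 * c)) / ENNReal.ofReal r) +
          c * ∑ t ∈ Iᶜ, μ {x | lab n (tower (n + 2) x) = t} := by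
        rw [mul_add]
        gcongr
      _ < ENNReal.ofReal (1 / 2) + ENNReal.ofReal (1 / 2) := by
        rw [h2]
        exact ENNReal.add_lt_add_left ENNReal.ofReal_ne_top hsm
      _ = 1 := by
        rw [← ENNReal.ofReal_add (by norm_num) (by norm_num)]
        norm_num
  exact lt_irrefl _ h3

end IsToeplitz

end OrderedBratteliDiagram

/-! ### Directedness of the set of limits -/

theorem exp_div_pow_div {b L : ℕ} (hL : 0 < L) (hbL : b ∣ L) :
    Complex.exp (2 * Complex.I * Real.pi / L) ^ (L / b) =
      Complex.exp (2 * Complex.I * Real.pi / b) := by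
  obtain ⟨k, rfl⟩ := hbL
  have hb : 0 < b := Nat.pos_of_mul_pos_right hL
  have hk : (k : ℂ) ≠ 0 := by exact_mod_cast (Nat.pos_of_mul_pos_left hL).ne'
  have hb0 : (b : ℂ) ≠ 0 := by exact_mod_cast hb.ne'
  rw [← Complex.exp_nat_mul, Nat.mul_div_cancel_left _ hb]
  congr 1
  push_cast
  field_simp

theorem norm_exp_div (b : ℕ) : ‖Complex.exp (2 * Complex.I * Real.pi / b)‖ = 1 := by
  rw [show 2 * Complex.I * Real.pi / b = ((2 * Real.pi / b : ℝ) : ℂ) * Complex.I by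
    push_cast; ring]
  exact Complex.norm_exp_ofReal_mul_I _

/-- With `L = lcm b₁ b₂`, the exponents `L / b₁` and `L / b₂` are coprime, so Bézout writes `exp
(2iπ/L)` as a product of integer powers of the two eigenvalues; the same powers of the unimodular
eigenfunctions are multiplied. -/
theorem isMeasurableEigenvalue_lcm {X : Type*} [MeasurableSpace X] {T : X → X} {μ : Measure X}
    [IsProbabilityMeasure μ] (hT : Ergodic T μ) {b₁ b₂ : ℕ} (hb₁ : 0 < b₁) (hb₂ : 0 < b₂)
    (h₁ : IsMeasurableEigenvalue T μ (Complex.exp (2 * Complex.I * Real.pi / b₁)))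
    (h₂ : IsMeasurableEigenvalue T μ (Complex.exp (2 * Complex.I * Real.pi / b₂))) :
    IsMeasurableEigenvalue T μ
      (Complex.exp (2 * Complex.I * Real.pi / (Nat.lcm b₁ b₂ : ℕ))) := by
  obtain ⟨f₁, hf₁, hn₁, hT₁⟩ := exists_unimodular_eigenfunction hT (norm_exp_div b₁) h₁
  obtain ⟨f₂, hf₂, hn₂, hT₂⟩ := exists_unimodular_eigenfunction hT (norm_exp_div b₂) h₂
  have hL := Nat.lcm_pos hb₁ hb₂
  rw [← exp_div_pow_div hL (Nat.dvd_lcm_left b₁ b₂)] at hT₁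
  rw [← exp_div_pow_div hL (Nat.dvd_lcm_right b₁ b₂)] at hT₂
  set a₁ := Nat.lcm b₁ b₂ / b₁ with ha₁
  set a₂ := Nat.lcm b₁ b₂ / b₂ with ha₂
  set ζ := Complex.exp (2 * Complex.I * Real.pi / (Nat.lcm b₁ b₂ : ℕ))
  have hcop : Nat.gcd a₁ a₂ = 1 := by
    have e₁ : a₁ = b₂ / Nat.gcd b₁ b₂ := by
      rw [ha₁, Nat.lcm, Nat.mul_div_assoc _ (Nat.gcd_dvd_right _ _), Nat.mul_div_cancel_left _ hb₁]
    have e₂ : a₂ = b₁ / Nat.gcd b₁ b₂ := by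
      rw [ha₂, Nat.lcm, mul_comm, Nat.mul_div_assoc _ (Nat.gcd_dvd_left _ _),
        Nat.mul_div_cancel_left _ hb₂]
    rw [e₁, e₂, Nat.gcd_comm]
    exact Nat.gcd_div_gcd_div_gcd_of_pos_left hb₁
  have hbez := Nat.gcd_eq_gcd_ab a₁ a₂
  rw [hcop] at hbez
  refine isMeasurableEigenvalue_of_unimodular
    (f := fun x => f₁ x ^ Nat.gcdA a₁ a₂ * f₂ x ^ Nat.gcdB a₁ a₂)
    ((hf₁.pow_const _).mul (hf₂.pow_const _)) (fun x => by simp [hn₁, hn₂]) ?_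
  filter_upwards [hT₁, hT₂] with x hx₁ hx₂
  have hζ : (ζ ^ a₁) ^ Nat.gcdA a₁ a₂ * (ζ ^ a₂) ^ Nat.gcdB a₁ a₂ = ζ := by
    rw [← zpow_natCast, ← zpow_natCast, ← zpow_mul, ← zpow_mul,
      ← zpow_add₀ (Complex.exp_ne_zero _), ← hbez]
    exact zpow_one ζ
  rw [hx₁, hx₂, mul_zpow, mul_zpow]
  nth_rewrite 3 [← hζ]
  ring

/-- Used in the contrapositive: non-continuity of `exp (2iπ/b₁)` passes to `exp (2iπ/L)`, of which
it is a power. -/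
theorem IsContinuousEigenvalue.pow {X : Type*} [TopologicalSpace X] {T : X → X} {l : ℂ}
    (h : IsContinuousEigenvalue T l) (k : ℕ) : IsContinuousEigenvalue T (l ^ k) := by
  obtain ⟨f, hf, hf0, hfT⟩ := h
  refine ⟨fun x => f x ^ k, hf.pow k, fun h => hf0 ?_, fun x => by simp only [hfT, mul_pow]⟩
  rcases k.eq_zero_or_pos with rfl | hk
  · ext x
    simpa using congrFun h x
  · ext x
    exact (pow_eq_zero_iff hk.ne').1 (congrFun h x)

theorem tendsto_div_gcd_iff {p : ℕ → ℕ} {b c : ℕ} :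
    Tendsto (fun m => b / Nat.gcd b (p m)) atTop (𝓝 c) ↔ ∀ᶠ m in atTop, b / Nat.gcd b (p m) = c := by
  rw [nhds_discrete, tendsto_pure]

/-- As `p m` grows for divisibility the gcd can only increase, and a decreasing sequence of naturals
converges. -/
theorem exists_tendsto_div_gcd {p : ℕ → ℕ} (hp : ∀ {m n}, m ≤ n → p m ∣ p n) {b : ℕ} (hb : 0 < b) :
    ∃ c, Tendsto (fun m => b / Nat.gcd b (p m)) atTop (𝓝 c) := by
  have hmono : Antitone fun m => b / Nat.gcd b (p m) := fun m n hmn =>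
    Nat.div_le_div_left
      (Nat.le_of_dvd (Nat.gcd_pos_of_pos_left _ hb) (Nat.gcd_dvd_gcd_of_dvd_right _ (hp hmn)))
      (Nat.gcd_pos_of_pos_left _ hb)
  exact ⟨_, tendsto_atTop_ciInf hmono (OrderBot.bddBelow _)⟩

/-- Multiplied by `p`, both sides become lcms with `p`, where divisibility is clear. -/
theorem div_gcd_dvd_div_gcd {b L p : ℕ} (hbL : b ∣ L) (hp : 0 < p) :
    b / Nat.gcd b p ∣ L / Nat.gcd L p := by
  have key : ∀ a : ℕ, Nat.lcm a p = a / Nat.gcd a p * p := fun a => by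
    rw [Nat.lcm, Nat.div_mul_right_comm (Nat.gcd_dvd_left a p)]
  refine Nat.dvd_of_mul_dvd_mul_right hp ?_
  rw [← key b, ← key L]
  exact Nat.lcm_dvd (hbL.trans (Nat.dvd_lcm_left _ _)) (Nat.dvd_lcm_right _ _)

namespace OrderedBratteliDiagram

variable {B : OrderedBratteliDiagram} {q : ℕ → ℕ}

/-- The set of limits is directed for divisibility. -/
theorem exists_common_multiple_mem_limitSet (hB : B.IsProperlyOrdered) {μ : Measure B.PathSpace}
    [IsProbabilityMeasure μ] (hT : Ergodic (vershikMap hB) μ) {c₁ c₂ : ℕ}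
    (hp : ∀ m, 0 < ∏ i ∈ Finset.range m, q i)
    (h₁ : c₁ ∈ limitSet hB q μ) (h₂ : c₂ ∈ limitSet hB q μ) :
    ∃ c ∈ limitSet hB q μ, c₁ ∣ c ∧ c₂ ∣ c := by
  obtain ⟨b₁, hb₁, hev₁, hlim₁⟩ := h₁
  obtain ⟨b₂, hb₂, hev₂, hlim₂⟩ := h₂
  have hL := Nat.lcm_pos hb₁ hb₂
  obtain ⟨c, hc⟩ := exists_tendsto_div_gcd (p := fun m => ∏ i ∈ Finset.range m, q i)
    (fun hmn => Finset.prod_dvd_prod_of_subset _ _ _ (Finset.range_mono hmn)) hL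
  refine ⟨c, ⟨_, hL, ⟨isMeasurableEigenvalue_lcm hT hb₁ hb₂ hev₁.1 hev₂.1, fun h => ?_⟩, hc⟩, ?_⟩
  · refine hev₁.2 ?_
    rw [← exp_div_pow_div hL (Nat.dvd_lcm_left b₁ b₂)]
    exact h.pow _
  · obtain ⟨m, hm, hm₁, hm₂⟩ := ((tendsto_div_gcd_iff.1 hc).and
      ((tendsto_div_gcd_iff.1 hlim₁).and (tendsto_div_gcd_iff.1 hlim₂))).exists
    rw [← hm, ← hm₁, ← hm₂]
    exact ⟨div_gcd_dvd_div_gcd (Nat.dvd_lcm_left _ _) (hp m),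
      div_gcd_dvd_div_gcd (Nat.dvd_lcm_right _ _) (hp m)⟩

end OrderedBratteliDiagram

/-- A bounded nonempty set of positive integers that is directed for divisibility has a greatest
element for divisibility. -/
theorem exists_isDvdMaximal {S : Set ℕ} {N : ℕ} (hS : S.Nonempty) (hpos : ∀ c ∈ S, 0 < c)
    (hN : ∀ c ∈ S, c ≤ N) (hdir : ∀ c₁ ∈ S, ∀ c₂ ∈ S, ∃ c ∈ S, c₁ ∣ c ∧ c₂ ∣ c) :
    ∃ b, IsDvdMaximal S b ∧ ∀ c, IsDvdMaximal S c → c = b := by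
  obtain ⟨b, hb, hmax⟩ := Set.exists_max_image S id ((Set.finite_Iic N).subset hN) hS
  -- A common multiple in `S` of `c` and the numerically largest element `b` must be `b` itself.
  have hdvd : ∀ c ∈ S, c ∣ b := by
    intro c hc
    obtain ⟨e, he, hbe, hce⟩ := hdir b hb c hc
    rwa [← (Nat.le_of_dvd (hpos e he) hbe).antisymm (hmax e he)] at hce
  exact ⟨b, ⟨hb, fun c hc hbc => Nat.dvd_antisymm (hdvd c hc) hbc⟩,
    fun c hc => (hc.2 b hb (hdvd c hc.1)).symm⟩

/-! ### Counting the disjoint sets of vertices -/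

theorem mainTheorem5 (B : OrderedBratteliDiagram) (hB : B.IsProperlyOrdered)
    (d : ℕ) (hproper : B.IsProper d) (lab : ∀ n, B.V (n + 2) ≃ Fin d)
    (q : ℕ → ℕ) (hq : B.IsToeplitz q)
    (I : Measure B.PathSpace → Finset (Fin d)) (hclean : B.IsClean hB lab I) :
    (∀ μ ∈ B.nonContinuousMeasures hB q, ∀ c ∈ B.limitSet hB q μ, c ≤ (I μ).card) ∧
    (B.ergodicMeasures hB).Finite ∧
    ∃ bmax : Measure B.PathSpace → ℕ,
      (∀ μ ∈ B.nonContinuousMeasures hB q,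
        IsDvdMaximal (B.limitSet hB q μ) (bmax μ) ∧
        ∀ c, IsDvdMaximal (B.limitSet hB q μ) c → c = bmax μ) ∧
      ∑ᶠ μ ∈ B.nonContinuousMeasures hB q, bmax μ ≤ d ∧
      (B.nonContinuousMeasures hB q).ncard ≤ (B.ergodicMeasures hB).ncard ∧
      ((B.ergodicMeasures hB).ncard : ℤ) ≤
        (d : ℤ) - ∑ᶠ μ ∈ B.nonContinuousMeasures hB q, ((bmax μ : ℤ) - 1) := by
  classical
  obtain ⟨-, hI, hdisj⟩ := hclean
  have hcard : ∀ μ ∈ B.ergodicMeasures hB, ∀ c ∈ B.limitSet hB q μ, c ≤ (I μ).card := by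
    rintro μ hμ c ⟨b, hb, hev, hlim⟩
    have := hμ.1
    exact hq.limit_le_card hB hμ.2 lab (hI μ hμ) hb hev.1 hlim
  have hone : ∀ μ ∈ B.ergodicMeasures hB, 1 ≤ (I μ).card := by
    intro μ hμ
    have := hμ.1
    -- The case `b = 1`: constants are eigenfunctions for the eigenvalue `1`, and the limit is `1`.
    refine hq.limit_le_card hB hμ.2 lab (hI μ hμ) one_pos ?_ (by simp)
    refine isMeasurableEigenvalue_of_unimodular (f := fun _ => 1) measurable_const
      (fun _ => norm_one) (ae_of_all _ fun _ => ?_)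
    rw [show 2 * Complex.I * Real.pi / (1 : ℕ) = 2 * Real.pi * Complex.I by push_cast; ring,
      Complex.exp_two_pi_mul_I, mul_one]
  have hsum : ∀ s : Finset (Measure B.PathSpace), ↑s ⊆ B.ergodicMeasures hB →
      ∑ μ ∈ s, (I μ).card ≤ d := by
    intro s hs
    rw [← Finset.card_biUnion fun μ hμ ν hν h => hdisj μ (hs hμ) ν (hs hν) h]
    exact (Finset.card_le_univ _).trans_eq (Fintype.card_fin d)
  have hfin : (B.ergodicMeasures hB).Finite := by
    by_contra h
    obtain ⟨s, hs, hsc⟩ := Set.Infinite.exists_subset_card_eq h (d + 1)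
    have h1 : s.card ≤ ∑ μ ∈ s, (I μ).card := by
      rw [Finset.card_eq_sum_ones]
      exact Finset.sum_le_sum fun μ hμ => hone μ (hs hμ)
    have := h1.trans (hsum s hs)
    omega
  have hsub : B.nonContinuousMeasures hB q ⊆ B.ergodicMeasures hB := fun μ hμ => hμ.1
  have hpos : ∀ μ, ∀ c ∈ B.limitSet hB q μ, 0 < c := by
    rintro μ c ⟨b, hb, -, hlim⟩
    obtain ⟨m, hm⟩ := (tendsto_div_gcd_iff.1 hlim).exists
    rw [← hm]
    exact Nat.div_pos (Nat.gcd_le_left _ hb) (Nat.gcd_pos_of_pos_left _ hb)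
  have hmax : ∀ μ, ∃ b, μ ∈ B.nonContinuousMeasures hB q →
      IsDvdMaximal (B.limitSet hB q μ) b ∧
        ∀ c, IsDvdMaximal (B.limitSet hB q μ) c → c = b := by
    intro μ
    by_cases hμ : μ ∈ B.nonContinuousMeasures hB q
    · have := hμ.1.1
      obtain ⟨x⟩ : Nonempty B.PathSpace := nonempty_of_isProbabilityMeasure μ
      obtain ⟨b, hb⟩ := exists_isDvdMaximal hμ.2 (hpos μ) (hcard μ hμ.1) fun c₁ h₁ c₂ h₂ =>
        B.exists_common_multiple_mem_limitSet hB hμ.1.2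
          (fun m => Nat.zero_lt_of_lt (hq.height_lt m x)) h₁ h₂
      exact ⟨b, fun _ => hb⟩
    -- The value outside the set of measures considered is irrelevant.
    · exact ⟨0, fun h => absurd h hμ⟩
  choose bmax hbmax using hmax
  have hble : ∀ μ ∈ B.nonContinuousMeasures hB q, bmax μ ≤ (I μ).card := fun μ hμ =>
    hcard μ hμ.1 _ (hbmax μ hμ).1.1
  have hM := hfin.subset hsub
  have hMsub : hM.toFinset ⊆ hfin.toFinset := Set.Finite.toFinset_subset_toFinset.2 hsub
  refine ⟨fun μ hμ => hcard μ hμ.1, hfin, bmax, hbmax, ?_, Set.ncard_le_ncard hsub hfin, ?_⟩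
  · rw [finsum_mem_eq_finite_toFinset_sum _ hM]
    refine le_trans (Finset.sum_le_sum fun μ hμ => hble μ (hM.mem_toFinset.1 hμ)) (hsum _ ?_)
    rwa [hM.coe_toFinset]
  · rw [finsum_mem_eq_finite_toFinset_sum _ hM, Set.ncard_eq_toFinset_card _ hfin]
    -- The ergodic measures without non continuous eigenvalue add terms `#(I μ) - 1`, nonnegative by
    -- `hone`.
    have h1 : ∑ μ ∈ hM.toFinset, ((bmax μ : ℤ) - 1) ≤
        ∑ μ ∈ hfin.toFinset, (((I μ).card : ℤ) - 1) := by
      refine (Finset.sum_le_sum fun μ hμ => ?_).trans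
        (Finset.sum_le_sum_of_subset_of_nonneg hMsub fun μ hμ _ => ?_)
      · have := hble μ (hM.mem_toFinset.1 hμ)
        omega
      · have := hone μ (hfin.mem_toFinset.1 hμ)
        omega
    have h2 : ∑ μ ∈ hfin.toFinset, (I μ).card ≤ d := hsum _ (by rw [hfin.coe_toFinset])
    have h3 : (∑ μ ∈ hfin.toFinset, ((I μ).card : ℤ)) ≤ d := by exact_mod_cast h2
    rw [Finset.sum_sub_distrib (s := hfin.toFinset)] at h1
    simp only [Finset.sum_const, nsmul_eq_mul, mul_one] at h1
    linarith
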